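/- All posets are finite, and $x\lessdot y$ means that $y$ covers $x$. A rank function on a poset $\mathcal P$ is a map $\mathrm{rk}:\mathcal P\to\mathbb Z_{\ge 0}$ that is strictly increasing, satisfies $\mathrm{rk}(y)=\mathrm{rk}(x)+1$ whenever $x\lessdot y$, and equals $1$ on all minimal elements. Write $\mathrm{rk}(\mathcal P)$ for its maximal value, $\dim(\mathcal P)=|\min(\mathcal P)|$, $\mathcal P_i=\{x\in\mathcal P:\mathrm{rk}(x)=i\}$, and $\mathcal E(v)$ for the set of elements covered by $v$. A *vine* is a poset $\mathcal P$ with a rank function $\mathrm{rk}$ such that every non-minimal element covers exactly two elements, any two distinct elements of the same rank are covered by at most one common element, and for $1\le i\le \mathrm{rk}(\mathcal P)$ the graph $F_i$ with node set $\mathcal P_i$ and edge set $\{\mathcal E(w): w\in\mathcal P_{i+1}\}$ is a forest. A vine is an *R-vine* if $\mathrm{rk}(\mathcal P)=\dim(\mathcal P)$, every $F_i$ ($1\le i\le\mathrm{rk}(\mathcal P)$) is a tree, and any two distinct elements of the same rank $i\ge 2$ that are covered by a common element also cover a common element. A vine is an *LR-vine* if each of its principal ideals $\{x: x\le a\}$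 is an R-vine (with the restricted rank function). For an element $v$ put $U_v=\{x\in\min(\mathcal P): x\le v\}$; if $\mathcal E(v)=\{a,b\}$, the conditioned set of $v$ is $C_v=U_a\,\triangle\,U_b$, and $C_v=\varnothing$ if $v$ is minimal. The *marginalization* $\mathcal P\,\|\,v$ by $v\in\min(\mathcal P)$ is the induced subposet $\mathcal P\setminus(\{v\}\cup\{x: v\in C_x\})$. An ordering $(v_1,\dots,v_\ell)$ of the minimal elements of an $\ell$-dimensional LR-vine $\mathcal P$ is a *sampling order* if, with $\mathcal P_{(\ell)}=\mathcal P$ and $\mathcal P_{(i)}=\mathcal P_{(i+1)}\,\|\,v_{i+1}$ (conditioned sets being taken in $\mathcal P_{(i+1)}$), the poset $\mathcal P_{(i)}$ is, for each $1\le i\le \ell-1$, an LR-vine whose rank function is the restriction of that of $\mathcal P$. For an LR-vine $\mathcal P$, the edge-labeled graph $\Omega(\mathcal P)=(G,\lambda)$ has vertex set $\min(\mathcal P)$, edge set $\{C_v: v\in\mathcal P\setminus\min(\mathcal P)\}$, and labels $\lambda(\{i,j\})=\mathrm{rk}(i\vee j)-1$, where $i\vee j$ is the join of $i$ and $j$ in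 $\mathcal P$. In an edge-labeled graph a vertex $v$ of degree $d$ is *MAT-simplicial* if its neighborhood is a clique, the set of labels of the edges at $v$ is $\{1,\dots,d\}$, and $\lambda(\{u_1,u_2\})<\max\{\lambda(\{u_1,v\}),\lambda(\{u_2,v\})\}$ for any distinct neighbors $u_1,u_2$ of $v$. An ordering $(v_1,\dots,v_\ell)$ of the vertices is an *MAT-PEO* if for each $1\le i\le\ell$ the vertex $v_i$ is MAT-simplicial in the subgraph induced on $\{v_1,\dots,v_i\}$ with the restricted labeling. **Theorem.** Let $\mathcal P$ be an $\ell$-dimensional LR-vine. If $(v_1,\dots,v_\ell)$ is an MAT-PEO of $\Omega(\mathcal P)$, then $(v_1,\dots,v_\ell)$ is a sampling order of $\mathcal P$. Moreover, every LR-vine has a sampling order. -/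

import Mathlib

namespace LRVine

/-! ### Graded posets and vines -/

section Poset

variable {α : Type*} [PartialOrder α]

/-- `rk` is a rank function: strictly increasing, going up by one along every cover relation, and
equal to `1` on the minimal elements. -/
structure IsRankFunction (rk : α → ℕ) : Prop where
  strictMono : StrictMono rk
  covBy : ∀ x y : α, x ⋖ y → rk x + 1 = rk y
  isMin : ∀ x : α, IsMin x → rk x = 1

/-- The dimension of a finite poset: its number of minimal elements. -/
noncomputable def dim (α : Type*) [PartialOrder α] : ℕ := {x : α | IsMin x}.ncard

/-- The rank of a finite graded poset: the maximal value of its rank function. -/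
noncomputable def posetRank (rk : α → ℕ) : ℕ := ⨆ x, rk x

/-- The set `ℰ(v)` of the elements covered by `v`. -/
def coveredSet (v : α) : Set α := {x | x ⋖ v}

/-- The `i`-th associated graph `F_i`: its nodes are the elements of rank `i`, its edges are the
pairs `ℰ(w)` for the elements `w` of rank `i + 1`. -/
def levelGraph (rk : α → ℕ) (i : ℕ) : SimpleGraph {x : α // rk x = i} where
  Adj a b := a ≠ b ∧ ∃ w : α, rk w = i + 1 ∧ coveredSet w = {a.1, b.1}
  symm := ⟨fun _ _ h => ⟨h.1.symm, by
    obtain ⟨w, hw, h2⟩ := h.2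
    exact ⟨w, hw, by rw [h2, Set.pair_comm]⟩⟩⟩
  loopless := ⟨fun _ h => h.1 rfl⟩

/-- A vine, as a finite graded poset. -/
structure IsVine [Finite α] (rk : α → ℕ) : Prop where
  isRankFunction : IsRankFunction rk
  ncard_coveredSet : ∀ v : α, ¬ IsMin v → (coveredSet v).ncard = 2
  eq_of_covBy : ∀ a b : α, a ≠ b → rk a = rk b →
    ∀ v w : α, a ⋖ v → b ⋖ v → a ⋖ w → b ⋖ w → v = w
  isForest : ∀ i : ℕ, 1 ≤ i → i ≤ posetRank rk → (levelGraph rk i).IsAcyclic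

/-- A regular vine. -/
structure IsRVine [Finite α] (rk : α → ℕ) : Prop where
  isVine : IsVine rk
  rank_eq_dim : posetRank rk = dim α
  isTree : ∀ i : ℕ, 1 ≤ i → i ≤ posetRank rk → (levelGraph rk i).IsTree
  proximity : ∀ i : ℕ, 2 ≤ i → ∀ a b : α, a ≠ b → rk a = i → rk b = i →
    (∃ v : α, a ⋖ v ∧ b ⋖ v) → ∃ c : α, c ⋖ a ∧ c ⋖ b

/-- A locally regular vine: a vine all of whose principal ideals are regular vines. -/
structure IsLRVine [Finite α] (rk : α → ℕ) : Prop where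
  isVine : IsVine rk
  isRVine_Iic : ∀ a : α, IsRVine (fun x : Set.Iic a => rk x)

/-- The complete union `U_v`: the minimal elements below `v`. -/
def completeUnion (v : α) : Set α := {x | IsMin x ∧ x ≤ v}

/-- The conditioned set `C_v = U_a ∆ U_b` of a node `v` with `ℰ(v) = {a, b}`. It is empty for
a minimal node. -/
def conditionedSet (v : α) : Set α :=
  {x | ∃ a b : α, coveredSet v = {a, b} ∧ x ∈ symmDiff (completeUnion a) (completeUnion b)}

/-- The marginalization `S ‖ v` of the induced subposet `S` by `v`: remove from `S` the node `v`
and the nodes whose conditioned sets, computed in the poset `S`, contain `v`. -/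
def marginalization (S : Set α) (v : α) : Set α :=
  {x | ∃ hx : x ∈ S, x ≠ v ∧ v ∉ Subtype.val '' conditionedSet (⟨x, hx⟩ : S)}

/-- The successive marginalizations `P_ℓ = P` and `P_i = P_{i+1} ‖ v_{i+1}`. In the zero-based
indexing of `Fin ℓ`, the element `v_{i+1}` is `v i`. -/
def successiveMarginalization {ℓ : ℕ} (v : Fin ℓ ≃ {x : α // IsMin x}) :
    Fin (ℓ + 1) → Set α :=
  Fin.reverseInduction (motive := fun _ => Set α) Set.univ
    (fun i S => marginalization S (v i).1)

/-- The ordering `(v_1, …, v_ℓ)` of the minimal nodes is a sampling order: for `1 ≤ i ≤ ℓ - 1`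
the marginalization `P_i` is an LR-vine graded by the restriction of `rk`. -/
def IsSamplingOrder [Finite α] (rk : α → ℕ) {ℓ : ℕ} (v : Fin ℓ ≃ {x : α // IsMin x}) : Prop :=
  ∀ i : Fin (ℓ + 1), 1 ≤ (i : ℕ) → (i : ℕ) ≤ ℓ - 1 →
    IsLRVine (fun x : successiveMarginalization v i => rk x)

end Poset

/-! ### Edge-labeled graphs -/

/-- A simple graph with labeled edges. The value of `label` at a pair that is not an edge is
irrelevant. -/
structure EdgeLabeledGraph (V : Type*) where
  graph : SimpleGraph V
  label : Sym2 V → ℕ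

namespace EdgeLabeledGraph

variable {V : Type*}

/-- The induced subgraph on `S`, with the restricted labeling. -/
def induce (Γ : EdgeLabeledGraph V) (S : Set V) : EdgeLabeledGraph S where
  graph := Γ.graph.induce S
  label e := Γ.label (e.map Subtype.val)

/-- `v` is an MAT-simplicial vertex. -/
structure IsMATSimplicial [Finite V] (Γ : EdgeLabeledGraph V) (v : V) : Prop where
  simplicial : Γ.graph.IsClique (Γ.graph.neighborSet v)
  labels : {k | ∃ u ∈ Γ.graph.neighborSet v, Γ.label s(u, v) = k} =
    Set.Icc 1 (Γ.graph.neighborSet v).ncard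
  lt_max : ∀ u₁ ∈ Γ.graph.neighborSet v, ∀ u₂ ∈ Γ.graph.neighborSet v, u₁ ≠ u₂ →
    Γ.label s(u₁, u₂) < max (Γ.label s(u₁, v)) (Γ.label s(u₂, v))

/-- The ordering `v` is an MAT-perfect elimination ordering: each `v i` is MAT-simplicial in the
labeled subgraph induced on the `v j` with `j ≤ i`. -/
def IsMATPEO [Finite V] (Γ : EdgeLabeledGraph V) {ℓ : ℕ} (v : Fin ℓ ≃ V) : Prop :=
  ∀ i : Fin ℓ, (Γ.induce (v '' Set.Iic i)).IsMATSimplicial ⟨v i, i, Set.self_mem_Iic, rfl⟩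

end EdgeLabeledGraph

open Classical in
/-- The edge-labeled graph `Ω(P)`: its vertices are the minimal nodes, its edges are the conditioned
sets of the non-minimal nodes, and the label of an edge `{i, j}` is `rk (i ∨ j) - 1`. -/
noncomputable def Omega {α : Type*} [PartialOrder α] (rk : α → ℕ) :
    EdgeLabeledGraph {x : α // IsMin x} where
  graph :=
    { Adj := fun i j => i ≠ j ∧ ∃ v : α, ¬ IsMin v ∧ conditionedSet v = {i.1, j.1}
      symm := ⟨fun _ _ h => ⟨h.1.symm, by
        obtain ⟨v, hv, h2⟩ := h.2
        exact ⟨v, hv, by rw [h2, Set.pair_comm]⟩⟩⟩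
      loopless := ⟨fun _ h => h.1 rfl⟩ }
  label e :=
    if h : ∃ w : α, IsLUB {x : α | ∃ i ∈ e, x = i.1} w then rk h.choose - 1 else 0

end LRVine

/-! The bridge between the two claims is `IsEliminationOrder`: the last minimal element below a node
lies in its conditioned set. For such an order each marginalization removes exactly the nodes above
the deleted element, so every stage is a lower set, and lower sets of an LR-vine are LR-vines
(`IsLRVine.subtype`).

An MAT-PEO is such an order. If the last element `v` lay below both elements `a`, `b` covered by
`x`, take `i` below `a` only and `j` below `b` only. Then `i ∨ j = x`, while `i ∨ v ≤ a` and `j ∨ v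
≤ b`, so the label of `{i, j}` exceeds both others, against MAT-simpliciality. The joins exist
because a forest has at most one path between two nodes (`exists_isGreatest`, `exists_isLUB`).

For existence it suffices to find, in every nonempty LR-vine, a minimal element that is never below
both elements covered by a node. Enlarge `F_1` to a spanning tree, then `F_2` to a spanning tree of
the line graph of that tree, and so on until one node is left. A leaf of each tree is a pendant edge
of the previous one, so leaves descend to the bottom level (`exists_leaf_isUnsplit`). Repeating this
on what remains builds the order from its end. -/

namespace LRVine

/-! ### Forests, line graphs and leaves. -/

section Graph

variable {V : Type*}

/-- In a forest, two reachability witnesses inside two subgraphs start with the same edge. -/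
theorem _root_.SimpleGraph.IsAcyclic.exists_adj_of_reachable_of_reachable {G H₁ H₂ : SimpleGraph V}
    (hG : G.IsAcyclic) (h₁ : H₁ ≤ G) (h₂ : H₂ ≤ G) {a b : V} (hab : a ≠ b)
    (r₁ : H₁.Reachable a b) (r₂ : H₂.Reachable a b) : ∃ c, H₁.Adj a c ∧ H₂.Adj a c := by
  obtain ⟨p, hp⟩ := r₁.exists_isPath
  obtain ⟨q, hq⟩ := r₂.exists_isPath
  have e := (hG.subsingleton_path a b).elim ⟨p.mapLe h₁, (SimpleGraph.Walk.isPath_mapLe h₁).2 hp⟩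
    ⟨q.mapLe h₂, (SimpleGraph.Walk.isPath_mapLe h₂).2 hq⟩
  rw [Subtype.mk.injEq] at e
  cases p with
  | nil => exact absurd rfl hab
  | @cons _ c _ hc p =>
    cases q with
    | nil => exact absurd rfl hab
    | @cons _ d _ hd q =>
      have := congrArg (fun w => w.snd) e
      simp at this
      subst this
      exact ⟨c, hc, hd⟩

/-- Edges that are connected in the line graph without passing through `e` have their ends connected
without passing through `e`. -/
theorem reachable_deleteEdges_of_reachable_lineGraph {G : SimpleGraph V} {e : G.edgeSet}
    {f g : ({e}ᶜ : Set G.edgeSet)} (h : (G.lineGraph.induce {e}ᶜ).Reachable f g) {x y : V}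
    (hx : x ∈ f.1.1) (hy : y ∈ g.1.1) : (G.deleteEdges {e.1}).Reachable x y := by
  have key : ∀ f : ({e}ᶜ : Set G.edgeSet), ∀ x ∈ f.1.1, ∀ y ∈ f.1.1,
      (G.deleteEdges {e.1}).Reachable x y := by
    rintro ⟨⟨f, hf⟩, hfe⟩ x hx y hy
    by_cases hxy : x = y
    · rw [hxy]
    · refine SimpleGraph.Adj.reachable ?_
      have : f = s(x, y) := (Sym2.mem_and_mem_iff hxy).1 ⟨hx, hy⟩
      subst this
      rw [SimpleGraph.deleteEdges_adj]
      exact ⟨hf, fun h => hfe (Subtype.ext h)⟩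
  obtain ⟨p⟩ := h
  induction p generalizing x with
  | nil => exact key _ _ hx _ hy
  | cons hadj p ih =>
    rw [SimpleGraph.comap_adj, SimpleGraph.lineGraph_adj_iff_exists] at hadj
    obtain ⟨-, z, hz, hz'⟩ := hadj
    exact (key _ _ hx _ hz).trans (ih hz' hy)

/-- A leaf of a connected spanning subgraph of the line graph of a tree is a pendant edge. -/
theorem exists_leaf_of_leaf_lineGraph [Finite V] {G : SimpleGraph V} (hG : G.IsAcyclic)
    {T : SimpleGraph G.edgeSet} (hT : T.Connected) (hTG : T ≤ G.lineGraph) {e : G.edgeSet}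
    (he : ∀ f g, T.Adj e f → T.Adj e g → f = g) :
    ∃ u ∈ e.1, ∀ f ∈ G.edgeSet, u ∈ f → f = e.1 := by
  classical
  obtain ⟨e, heG⟩ := e
  induction e using Sym2.ind with
  | _ i j =>
  by_contra! hcon
  obtain ⟨f, hf, hif, hfe⟩ := hcon i (by simp)
  obtain ⟨g, hg, hjg, hge⟩ := hcon j (by simp)
  have := Fintype.ofFinite G.edgeSet
  have hdeg : T.degree ⟨s(i, j), heG⟩ = 1 := by
    rw [SimpleGraph.degree_eq_one_iff_existsUnique_adj]
    obtain ⟨p⟩ := hT.preconnected ⟨s(i, j), heG⟩ ⟨f, hf⟩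
    cases p with
    | nil => exact absurd rfl hfe
    | cons h p => exact ⟨_, h, fun g hg => he _ _ hg h⟩
  -- `T` stays connected without its leaf, so the other edges at `i` and `j` are linked while
  -- avoiding `s(i, j)`, which is a bridge of the forest.
  have hc := (hT.induce_compl_singleton_of_degree_eq_one hdeg).preconnected
    ⟨⟨f, hf⟩, fun h => hfe (congrArg Subtype.val h)⟩
    ⟨⟨g, hg⟩, fun h => hge (congrArg Subtype.val h)⟩
  have hc' : (G.lineGraph.induce {(⟨s(i, j), heG⟩ : G.edgeSet)}ᶜ).Reachable _ _ :=
    hc.mono (fun a b h => hTG h)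
  have hr := reachable_deleteEdges_of_reachable_lineGraph hc' hif hjg
  have hb := SimpleGraph.isAcyclic_iff_forall_adj_isBridge.1 hG heG
  rw [SimpleGraph.isBridge_iff] at hb
  exact hb hr

theorem lineGraph_connected {G : SimpleGraph V} (hG : G.Connected) (hne : G.edgeSet.Nonempty) :
    G.lineGraph.Connected := by
  have := hne.to_subtype
  refine ⟨?_⟩
  have key : ∀ x y (p : G.Walk x y) (f g : G.edgeSet), x ∈ f.1 → y ∈ g.1 →
      G.lineGraph.Reachable f g := by
    have base : ∀ x (f g : G.edgeSet), x ∈ f.1 → x ∈ g.1 → G.lineGraph.Reachable f g := by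
      intro x f g hf hg
      by_cases h : f = g
      · rw [h]
      · exact SimpleGraph.Adj.reachable (SimpleGraph.lineGraph_adj_iff_exists.2 ⟨h, x, hf, hg⟩)
    intro x y p
    induction p with
    | nil => exact base _
    | @cons u v w h p ih =>
      intro f g hf hg
      exact (base u f ⟨s(u, v), h⟩ hf (by simp)).trans (ih _ g (by simp) hg)
  intro f g
  obtain ⟨p⟩ := hG.preconnected f.1.out.1 g.1.out.1
  exact key _ _ p f g (Sym2.out_fst_mem _) (Sym2.out_fst_mem _)

/-- A walk of the image that starts in the range of `f` never leaves it and lifts to `G`, so bridges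
map to bridges. -/
theorem _root_.SimpleGraph.IsAcyclic.map {W : Type*} {G : SimpleGraph V} (hG : G.IsAcyclic)
    {f : V → W} (hf : Function.Injective f) : (G.map f).IsAcyclic := by
  rw [SimpleGraph.isAcyclic_iff_forall_adj_isBridge] at hG ⊢
  rintro _ _ ⟨-, v, w, hvw, rfl, rfl⟩
  have key : ∀ a b, ((G.map f).deleteEdges {s(f v, f w)}).Walk a b → ∀ u, a = f u →
      ∃ u', b = f u' ∧ (G.deleteEdges {s(v, w)}).Reachable u u' := by
    intro a b p
    induction p with
    | nil => exact fun u hu => ⟨u, hu, SimpleGraph.Reachable.refl _⟩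
    | cons hadj p ih =>
      rintro u rfl
      rw [SimpleGraph.deleteEdges_adj] at hadj
      obtain ⟨⟨-, x, y, hxy, hx, rfl⟩, hne⟩ := hadj
      obtain rfl := hf hx
      obtain ⟨u', rfl, hr⟩ := ih y rfl
      refine ⟨u', rfl, SimpleGraph.Reachable.trans (SimpleGraph.Adj.reachable ?_) hr⟩
      rw [SimpleGraph.deleteEdges_adj]
      refine ⟨hxy, fun h => hne ?_⟩
      have := congrArg (Sym2.map f) (Set.mem_singleton_iff.1 h)
      simpa using this
  have hb := hG hvw
  rw [SimpleGraph.isBridge_iff] at hb ⊢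
  rintro ⟨p⟩
  obtain ⟨u', hu', hr⟩ := key _ _ p v rfl
  obtain rfl := hf hu'
  exact hb hr

end Graph

/-! ### Basic properties of vines. -/

section Vine

theorem rk_le_posetRank {α : Type*} [Finite α] (rk : α → ℕ) (a : α) : rk a ≤ posetRank rk :=
  le_ciSup (Set.finite_range rk).bddAbove a

variable {α : Type*} [PartialOrder α]

theorem covBy_of_coveredSet_eq {a b v : α} (h : coveredSet v = {a, b}) : a ⋖ v ∧ b ⋖ v := by
  have ha : a ∈ coveredSet v := h ▸ Set.mem_insert a _
  have hb : b ∈ coveredSet v := h ▸ Set.mem_insert_of_mem _ rfl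
  exact ⟨ha, hb⟩

theorem le_or_le_of_coveredSet_eq [Finite α] {a b v z : α} (e : coveredSet v = {a, b})
    (hz : z < v) : z ≤ a ∨ z ≤ b := by
  obtain ⟨c, hzc, hc⟩ := exists_le_covBy_of_lt hz
  have hc : c ∈ coveredSet v := hc
  rw [e] at hc
  rcases hc with rfl | rfl
  · exact Or.inl hzc
  · exact Or.inr hzc

theorem isLowerSet_range_subtype {S : Set α} (hS : IsLowerSet S) :
    IsLowerSet (Set.range (OrderEmbedding.subtype (· ∈ S))) := by
  rintro a b hba ⟨c, rfl⟩
  exact ⟨⟨b, hS hba c.2⟩, rfl⟩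

theorem covBy_subtype_iff {S : Set α} (hS : IsLowerSet S) {a b : S} : a ⋖ b ↔ a.1 ⋖ b.1 :=
  (Set.OrdConnected.apply_covBy_apply_iff (OrderEmbedding.subtype (· ∈ S))
    (isLowerSet_range_subtype hS).ordConnected).symm

theorem covBy_Iic_iff {x : α} {a b : Set.Iic x} : a ⋖ b ↔ a.1 ⋖ b.1 :=
  covBy_subtype_iff (isLowerSet_Iic x)

variable {rk : α → ℕ}

theorem IsRankFunction.rk_eq_of_covBy (h : IsRankFunction rk) {a b x : α} (ha : a ⋖ x)
    (hb : b ⋖ x) : rk a = rk b := by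
  have := h.covBy _ _ ha
  have := h.covBy _ _ hb
  omega

variable [Finite α]

theorem IsRankFunction.one_le (h : IsRankFunction rk) (a : α) : 1 ≤ rk a := by
  obtain ⟨b, hb, hmin⟩ := Finite.exists_le_minimal (p := fun _ : α => True) (a := a) trivial
  have := h.isMin b (minimal_true.1 hmin)
  have := h.strictMono.monotone hb
  omega

theorem IsRankFunction.isMin_iff (h : IsRankFunction rk) (a : α) : IsMin a ↔ rk a = 1 := by
  refine ⟨h.isMin a, fun ha b hb => ?_⟩
  rcases hb.eq_or_lt with rfl | hlt
  · exact le_rfl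
  · have := h.strictMono hlt
    have := h.one_le b
    omega

theorem IsVine.exists_coveredSet_eq (h : IsVine rk) {v : α} (hv : ¬ IsMin v) :
    ∃ a b : α, a ≠ b ∧ coveredSet v = {a, b} :=
  Set.ncard_eq_two.1 (h.ncard_coveredSet v hv)

theorem IsVine.coveredSet_eq_of_covBy (h : IsVine rk) {a b v : α} (hab : a ≠ b) (ha : a ⋖ v)
    (hb : b ⋖ v) : coveredSet v = {a, b} := by
  obtain ⟨c, d, hcd, e⟩ := h.exists_coveredSet_eq (v := v) (fun hm => ha.lt.not_isMin hm)
  have h1 : a ∈ coveredSet v := ha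
  have h2 : b ∈ coveredSet v := hb
  rw [e] at h1 h2 ⊢
  rcases h1 with rfl | rfl <;> rcases h2 with rfl | rfl
  · exact absurd rfl hab
  · rfl
  · exact Set.pair_comm _ _
  · exact absurd rfl hab

theorem IsVine.eq_of_coveredSet_eq (h : IsVine rk) {a b v w : α} (hab : a ≠ b)
    (hv : coveredSet v = {a, b}) (hw : coveredSet w = {a, b}) : v = w := by
  obtain ⟨h1, h2⟩ := covBy_of_coveredSet_eq hv
  obtain ⟨h3, h4⟩ := covBy_of_coveredSet_eq hw
  exact h.eq_of_covBy a b hab (h.isRankFunction.rk_eq_of_covBy h1 h2) v w h1 h2 h3 h4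

/-- Levels beyond the rank are empty, so the upper bound on `i` can be dropped. -/
theorem IsVine.levelGraph_isAcyclic (h : IsVine rk) {i : ℕ} (hi : 1 ≤ i) :
    (levelGraph rk i).IsAcyclic := by
  by_cases hr : i ≤ posetRank rk
  · exact h.isForest i hi hr
  · have : IsEmpty {x : α // rk x = i} := ⟨fun x => hr (x.2 ▸ rk_le_posetRank rk x.1)⟩
    exact SimpleGraph.IsAcyclic.of_subsingleton

/-- If `a` is alone at its level, then there is nothing above its level. -/
theorem IsVine.eq_of_level_subsingleton (h : IsVine rk) {a x : α}
    (hs : ∀ b, rk b = rk a → b = a) (hx : rk a ≤ rk x) : x = a := by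
  induction hn : rk x - rk a generalizing x with
  | zero => exact hs x (by omega)
  | succ n ih =>
    have h1 := h.isRankFunction.one_le a
    obtain ⟨p, q, hpq, e⟩ := h.exists_coveredSet_eq (v := x) (fun hm => by
      have := h.isRankFunction.isMin x hm
      omega)
    obtain ⟨hp, hq⟩ := covBy_of_coveredSet_eq e
    have rp := h.isRankFunction.covBy _ _ hp
    have rq := h.isRankFunction.covBy _ _ hq
    exact absurd ((ih (x := p) (by omega) (by omega)).trans
      (ih (x := q) (by omega) (by omega)).symm) hpq

/-- Proximity is applied in the principal ideal of `x`, where `x` is the common cover. -/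
theorem IsLRVine.exists_covBy_covBy (h : IsLRVine rk) {p q x : α} (hpq : p ≠ q) (hp : p ⋖ x)
    (hq : q ⋖ x) (hr : 2 ≤ rk p) : ∃ c, c ⋖ p ∧ c ⋖ q := by
  obtain ⟨c, h1, h2⟩ := (h.isRVine_Iic x).proximity (rk p) hr ⟨p, hp.le⟩ ⟨q, hq.le⟩
    (fun e => hpq (congrArg Subtype.val e)) rfl (h.isVine.isRankFunction.rk_eq_of_covBy hq hp)
    ⟨⟨x, le_rfl⟩, covBy_Iic_iff.2 hp, covBy_Iic_iff.2 hq⟩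
  exact ⟨c.1, covBy_Iic_iff.1 h1, covBy_Iic_iff.1 h2⟩

end Vine

/-! ### Existence of an unsplit minimal element. -/

section Unsplit

universe u
variable {α : Type u} [PartialOrder α]

/-- `a` is unsplit if it lies below at most one of the elements covered by any given element. -/
def IsUnsplit (a : α) : Prop := ∀ x p q : α, p ⋖ x → q ⋖ x → a ≤ p → a ≤ q → p = q

variable [Finite α] {rk : α → ℕ}

/-- If `a` lies below distinct `p`, `q` covered by `x`, equality of ranks puts it strictly below
both; its only cover then lies below both as well. -/
theorem IsLRVine.isUnsplit_of_covBy (h : IsLRVine rk) {a : α}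
    (hcov : ∀ e f, a ⋖ e → a ⋖ f → e = f) (hup : ∀ e, a ⋖ e → IsUnsplit e) : IsUnsplit a := by
  intro x p q hp hq hap haq
  have hr := h.isVine.isRankFunction.rk_eq_of_covBy hp hq
  rcases hap.eq_or_lt with rfl | hap
  · rcases haq.eq_or_lt with rfl | haq
    · rfl
    · have := h.isVine.isRankFunction.strictMono haq
      omega
  rcases haq.eq_or_lt with rfl | haq
  · have := h.isVine.isRankFunction.strictMono hap
    omega
  obtain ⟨e, hae, hep⟩ := exists_covBy_le_of_lt hap
  obtain ⟨f, haf, hfq⟩ := exists_covBy_le_of_lt haq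
  obtain rfl := hcov e f hae haf
  exact hup e hae x p q hp hq hep hfq

/-- `G` is a tree containing a copy of `F_k`. Its added edges become nodes one level up that
represent no element of the poset, hence the arbitrary node type `N` and the injection `ι`. The
induction is on the number `n` of edges of `G`, which are the nodes of the next tree. -/
theorem IsLRVine.exists_leaf_isUnsplit (h : IsLRVine rk) (n : ℕ) :
    ∀ (N : Type u) [Finite N] (k : ℕ), 1 ≤ k → ∀ ι : {x : α // rk x = k} → N,
      Function.Injective ι → ∀ G : SimpleGraph N, G.IsTree →
      (∀ a b, (levelGraph rk k).Adj a b → G.Adj (ι a) (ι b)) → Nat.card N = n + 1 →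
      ∃ u, (∀ b c, G.Adj u b → G.Adj u c → b = c) ∧ ∀ a, ι a = u → IsUnsplit a.1 := by
  have hrk := h.isVine.isRankFunction
  induction n with
  | zero =>
    intro N _ k hk ι hι G hG hadj hcard
    have : Subsingleton N := (Nat.card_eq_one_iff_unique.1 hcard).1
    obtain ⟨u⟩ := hG.connected.nonempty
    refine ⟨u, fun b c _ _ => Subsingleton.elim _ _, fun a _ x p q _ _ hap haq => ?_⟩
    have hs : ∀ b, rk b = rk a.1 → b = a.1 := fun b hb =>
      congrArg Subtype.val (hι (Subsingleton.elim (ι ⟨b, hb.trans a.2⟩) (ι a)))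
    rw [h.isVine.eq_of_level_subsingleton hs (hrk.strictMono.monotone hap),
      h.isVine.eq_of_level_subsingleton hs (hrk.strictMono.monotone haq)]
  | succ n ih =>
    intro N _ k hk ι hι G hG hadj hcard
    classical
    have hcardE : Nat.card G.edgeSet = n + 1 := by
      have := (SimpleGraph.isTree_iff_connected_and_card.1 hG).2
      omega
    have hne : G.edgeSet.Nonempty := by
      rw [Set.nonempty_iff_ne_empty]
      intro h0
      rw [h0] at hcardE
      simp at hcardE
    have hpair : ∀ w : {x : α // rk x = k + 1}, ∃ a b : {x : α // rk x = k},
        a ≠ b ∧ coveredSet w.1 = {a.1, b.1} := by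
      intro w
      obtain ⟨a, b, hab, e⟩ := h.isVine.exists_coveredSet_eq (v := w.1) (fun hm => by
        have := hrk.isMin w.1 hm
        have := w.2
        omega)
      obtain ⟨ha, hb⟩ := covBy_of_coveredSet_eq e
      have ha := hrk.covBy _ _ ha
      have hb := hrk.covBy _ _ hb
      have := w.2
      exact ⟨⟨a, by omega⟩, ⟨b, by omega⟩, fun e => hab (congrArg Subtype.val e), e⟩
    choose p q hpq hw using hpair
    have hG' : ∀ w, G.Adj (ι (p w)) (ι (q w)) := fun w => hadj _ _ ⟨hpq w, w.1, w.2, hw w⟩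
    let κ : {x : α // rk x = k + 1} → G.edgeSet := fun w => ⟨s(ι (p w), ι (q w)), hG' w⟩
    have hmem : ∀ w a, ι a ∈ (κ w).1 ↔ a.1 ⋖ w.1 := by
      intro w a
      have : a.1 ⋖ w.1 ↔ a.1 ∈ coveredSet w.1 := Iff.rfl
      rw [this, hw w]
      simp [κ, hι.eq_iff, Subtype.ext_iff]
    have hκ : Function.Injective κ := by
      intro v w hvw
      have h1 := (hmem w (p v)).1 (hvw ▸ by simp [κ])
      have h2 := (hmem w (q v)).1 (hvw ▸ by simp [κ])
      exact Subtype.ext (h.isVine.eq_of_coveredSet_eq (fun e => hpq v (Subtype.ext e)) (hw v)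
        (h.isVine.coveredSet_eq_of_covBy (fun e => hpq v (Subtype.ext e)) h1 h2))
    -- By proximity, adjacent nodes of `F_{k+1}` are edges of `G` with a common end, so the copy of
    -- `F_{k+1}` lies in the line graph and extends to a spanning tree of it.
    obtain ⟨T, hHT, hTL, hT⟩ :=
      (lineGraph_connected hG.connected hne).exists_isTree_le_of_le_of_isAcyclic
      (H := (levelGraph rk (k + 1)).map κ) (by
        rintro e f ⟨hef, v, w, hvw, rfl, rfl⟩
        rw [SimpleGraph.lineGraph_adj_iff_exists]
        refine ⟨hef, ?_⟩
        obtain ⟨hne, x, hx, e⟩ := hvw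
        obtain ⟨hv, hw⟩ := covBy_of_coveredSet_eq e
        obtain ⟨c, hc, hc'⟩ := h.exists_covBy_covBy (fun e => hne (Subtype.ext e)) hv hw
          (by have := v.2; omega)
        have hck : rk c = k := by
          have := hrk.covBy _ _ hc
          have := v.2
          omega
        exact ⟨ι ⟨c, hck⟩, (hmem v ⟨c, hck⟩).2 hc, (hmem w ⟨c, hck⟩).2 hc'⟩)
      ((h.isVine.levelGraph_isAcyclic (by omega)).map hκ)
    obtain ⟨e, he, hgood⟩ := ih G.edgeSet (k + 1) (by omega) κ hκ T hT
      (fun a b hab => hHT ⟨hκ.ne hab.ne, a, b, hab, rfl, rfl⟩) hcardE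
    obtain ⟨u, hue, hu⟩ := exists_leaf_of_leaf_lineGraph hG.isAcyclic hT.connected hTL he
    refine ⟨u, fun b c hb hc => ?_, fun a hau => ?_⟩
    · have h1 := hu s(u, b) hb (by simp)
      have h2 := hu s(u, c) hc (by simp)
      rw [← h2] at h1
      exact Sym2.congr_right.1 h1
    -- Covers of `a` are edges of `G` at the leaf `u`, and `e` is the only one.
    · have hcov : ∀ f (hf : a.1 ⋖ f), κ ⟨f, by rw [← hrk.covBy _ _ hf, a.2]⟩ = e := by
        intro f hf
        exact Subtype.ext (hu _ (κ _).2 (by rw [← hau, hmem]; exact hf))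
      refine h.isUnsplit_of_covBy (fun f g hf hg => ?_) (fun f hf => ?_)
      · exact congrArg Subtype.val (hκ ((hcov f hf).trans (hcov g hg).symm))
      · exact hgood _ (hcov f hf)

theorem IsLRVine.exists_isMin_isUnsplit (h : IsLRVine rk) [Nonempty α] :
    ∃ v : α, IsMin v ∧ IsUnsplit v := by
  have hrk := h.isVine.isRankFunction
  obtain ⟨m, -, hm⟩ := Finite.exists_le_minimal (p := fun _ : α => True)
    (a := Classical.arbitrary α) trivial
  have : Nonempty {x : α // rk x = 1} := ⟨⟨m, hrk.isMin m (minimal_true.1 hm)⟩⟩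
  obtain ⟨T, hT, -, hT'⟩ := (SimpleGraph.connected_top (V := {x : α // rk x = 1}))
    |>.exists_isTree_le_of_le_of_isAcyclic le_top (h.isVine.levelGraph_isAcyclic le_rfl)
  obtain ⟨u, -, hu⟩ := h.exists_leaf_isUnsplit (Nat.card {x : α // rk x = 1} - 1) _ 1 le_rfl id
    Function.injective_id T hT' (fun a b hab => hT hab)
    (by have := Nat.card_pos (α := {x : α // rk x = 1}); omega)
  exact ⟨u.1, (hrk.isMin_iff _).2 u.2, hu u rfl⟩

end Unsplit

/-! ### Restriction of vines to lower sets. -/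

section LowerSet

variable {α β : Type*} [PartialOrder α] [PartialOrder β]

theorem isMin_apply_iff_of_isLowerSet_range {f : α ↪o β} (hf : IsLowerSet (Set.range f)) {a : α} :
    IsMin (f a) ↔ IsMin a := by
  refine ⟨fun h b hb => f.le_iff_le.1 (h (f.le_iff_le.2 hb)), fun h b hb => ?_⟩
  obtain ⟨c, rfl⟩ := hf hb ⟨a, rfl⟩
  exact f.le_iff_le.2 (h (f.le_iff_le.1 hb))

theorem covBy_apply_iff_of_isLowerSet_range {f : α ↪o β} (hf : IsLowerSet (Set.range f))
    {a b : α} : f a ⋖ f b ↔ a ⋖ b :=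
  Set.OrdConnected.apply_covBy_apply_iff f hf.ordConnected

theorem coveredSet_apply_of_isLowerSet_range {f : α ↪o β} (hf : IsLowerSet (Set.range f)) (a : α) :
    coveredSet (f a) = f '' coveredSet a := by
  ext x
  constructor
  · intro hx
    obtain ⟨c, rfl⟩ := hf hx.le ⟨a, rfl⟩
    exact ⟨c, (covBy_apply_iff_of_isLowerSet_range hf).1 hx, rfl⟩
  · rintro ⟨c, hc, rfl⟩
    exact (covBy_apply_iff_of_isLowerSet_range hf).2 hc

theorem completeUnion_apply_of_isLowerSet_range {f : α ↪o β} (hf : IsLowerSet (Set.range f))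
    (a : α) : completeUnion (f a) = f '' completeUnion a := by
  ext x
  constructor
  · rintro ⟨hx, hxa⟩
    obtain ⟨c, rfl⟩ := hf hxa ⟨a, rfl⟩
    exact ⟨c, ⟨(isMin_apply_iff_of_isLowerSet_range hf).1 hx, f.le_iff_le.1 hxa⟩, rfl⟩
  · rintro ⟨c, ⟨hc, hca⟩, rfl⟩
    exact ⟨(isMin_apply_iff_of_isLowerSet_range hf).2 hc, f.le_iff_le.2 hca⟩

/-- Only the ideal below `a` matters, so conditioned sets in a marginalization that is a lower set
can be computed in the whole poset. -/
theorem conditionedSet_apply_of_isLowerSet_range {f : α ↪o β} (hf : IsLowerSet (Set.range f))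
    (a : α) : conditionedSet (f a) = f '' conditionedSet a := by
  have key : ∀ c d, f '' symmDiff (completeUnion c) (completeUnion d) =
      symmDiff (completeUnion (f c)) (completeUnion (f d)) := by
    intro c d
    rw [Set.image_symmDiff f.injective, completeUnion_apply_of_isLowerSet_range hf,
      completeUnion_apply_of_isLowerSet_range hf]
  ext x
  constructor
  · rintro ⟨c, d, hcd, hx⟩
    obtain ⟨hc, hd⟩ := covBy_of_coveredSet_eq hcd
    obtain ⟨c, rfl⟩ := hf hc.le ⟨a, rfl⟩
    obtain ⟨d, rfl⟩ := hf hd.le ⟨a, rfl⟩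
    rw [← key] at hx
    obtain ⟨y, hy, rfl⟩ := hx
    refine ⟨y, ⟨c, d, f.injective.image_injective ?_, hy⟩, rfl⟩
    rw [← coveredSet_apply_of_isLowerSet_range hf, hcd, Set.image_pair]
  · rintro ⟨y, ⟨c, d, hcd, hy⟩, rfl⟩
    refine ⟨f c, f d, ?_, key c d ▸ Set.mem_image_of_mem f hy⟩
    rw [coveredSet_apply_of_isLowerSet_range hf, hcd, Set.image_pair]

variable {rk : β → ℕ}

theorem levelGraph_adj_of_isLowerSet_range {f : α ↪o β} (hf : IsLowerSet (Set.range f)) {i : ℕ}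
    {a b : {x : α // rk (f x) = i}} (h : (levelGraph (fun x => rk (f x)) i).Adj a b) :
    (levelGraph rk i).Adj ⟨f a.1, a.2⟩ ⟨f b.1, b.2⟩ := by
  obtain ⟨hne, w, hw, e⟩ := h
  refine ⟨fun e => hne (Subtype.ext (f.injective (congrArg Subtype.val e))), f w, hw, ?_⟩
  rw [coveredSet_apply_of_isLowerSet_range hf, e, Set.image_pair]

variable [Finite α] [Finite β]

theorem IsVine.comp_of_isLowerSet_range (h : IsVine rk) (f : α ↪o β)
    (hf : IsLowerSet (Set.range f)) : IsVine (fun x => rk (f x)) where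
  isRankFunction :=
    { strictMono := h.isRankFunction.strictMono.comp f.strictMono
      covBy := fun x y hxy =>
        h.isRankFunction.covBy _ _ ((covBy_apply_iff_of_isLowerSet_range hf).2 hxy)
      isMin := fun x hx =>
        h.isRankFunction.isMin _ ((isMin_apply_iff_of_isLowerSet_range hf).2 hx) }
  ncard_coveredSet := fun v hv => by
    rw [← Set.ncard_image_of_injective _ f.injective, ← coveredSet_apply_of_isLowerSet_range hf]
    exact h.ncard_coveredSet _ (fun h => hv ((isMin_apply_iff_of_isLowerSet_range hf).1 h))
  eq_of_covBy := fun a b hab hr v w h1 h2 h3 h4 => f.injective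
    (h.eq_of_covBy (f a) (f b) (f.injective.ne hab) hr _ _
      ((covBy_apply_iff_of_isLowerSet_range hf).2 h1)
      ((covBy_apply_iff_of_isLowerSet_range hf).2 h2)
      ((covBy_apply_iff_of_isLowerSet_range hf).2 h3)
      ((covBy_apply_iff_of_isLowerSet_range hf).2 h4))
  isForest := fun i hi _ => (h.levelGraph_isAcyclic hi).comap
    ⟨fun a => ⟨f a.1, a.2⟩, fun hab => levelGraph_adj_of_isLowerSet_range hf hab⟩
    (fun _ _ e => Subtype.ext (f.injective (congrArg Subtype.val e)))

theorem IsRVine.comp_orderIso (h : IsRVine rk) (f : α ≃o β) : IsRVine (fun x => rk (f x)) := by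
  have hr : posetRank (fun x => rk (f x)) = posetRank rk := f.toEquiv.iSup_congr fun _ => rfl
  have hf : IsLowerSet (Set.range (f : α ↪o β)) := by
    exact fun _ b _ _ => f.surjective b
  have hg : IsLowerSet (Set.range (f.symm : β ↪o α)) := by
    exact fun _ b _ _ => f.symm.surjective b
  refine ⟨h.isVine.comp_of_isLowerSet_range (f : α ↪o β) hf, ?_, ?_, ?_⟩
  · rw [hr, h.rank_eq_dim, dim, dim, ← Set.ncard_image_of_injective _ f.injective]
    congr 1
    ext x
    constructor
    · intro hx
      exact ⟨f.symm x, f.symm.isMin_apply.2 hx, f.apply_symm_apply x⟩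
    · rintro ⟨y, hy, rfl⟩
      exact f.isMin_apply.2 hy
  · intro i hi hir
    rw [hr] at hir
    let e : levelGraph (fun x => rk (f x)) i ≃g levelGraph rk i :=
      { toFun := fun a => ⟨f a.1, a.2⟩
        invFun := fun a => ⟨f.symm a.1, by simpa using a.2⟩
        left_inv := fun a => Subtype.ext (by simp)
        right_inv := fun a => Subtype.ext (by simp)
        map_rel_iff' := by
          intro a b
          refine ⟨fun hab => ?_, fun hab => levelGraph_adj_of_isLowerSet_range hf hab⟩
          obtain ⟨hne, w, hw, e⟩ := hab
          refine ⟨fun e => hne (e ▸ rfl), f.symm w, by simpa using hw, ?_⟩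
          have := coveredSet_apply_of_isLowerSet_range hg w
          refine this.trans ?_
          rw [e, Set.image_pair]
          exact congrArg₂ _ (f.symm_apply_apply _) (congrArg _ (f.symm_apply_apply _)) }
    exact e.isTree_iff.2 (h.isTree i hi hir)
  · rintro i hi a b hab ha hb ⟨v, hav, hbv⟩
    obtain ⟨c, h1, h2⟩ := h.proximity i hi (f a) (f b) (f.injective.ne hab) ha hb
      ⟨f v, (apply_covBy_apply_iff f).2 hav, (apply_covBy_apply_iff f).2 hbv⟩
    exact ⟨f.symm c, by rwa [← apply_covBy_apply_iff f, f.apply_symm_apply],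
      by rwa [← apply_covBy_apply_iff f, f.apply_symm_apply]⟩

/-- A principal ideal of `S` is a principal ideal of the whole poset. -/
theorem IsLRVine.subtype (h : IsLRVine rk) {S : Set β} (hS : IsLowerSet S) :
    IsLRVine (fun x : S => rk x) := by
  have hS' := isLowerSet_range_subtype hS
  refine ⟨h.isVine.comp_of_isLowerSet_range (OrderEmbedding.subtype (· ∈ S)) hS', fun a => ?_⟩
  let e : Set.Iic a ≃o Set.Iic a.1 :=
    { toFun := fun x => ⟨x.1.1, x.2⟩
      invFun := fun x => ⟨⟨x.1, hS x.2 a.2⟩, x.2⟩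
      left_inv := fun _ => rfl
      right_inv := fun _ => rfl
      map_rel_iff' := Iff.rfl }
  exact (h.isRVine_Iic a.1).comp_orderIso e

end LowerSet

/-! ### Elimination orders are sampling orders. -/

section Sampling

variable {α : Type*} [PartialOrder α]

theorem conditionedSet_subset_completeUnion (x : α) : conditionedSet x ⊆ completeUnion x := by
  rintro y ⟨a, b, e, hy⟩
  obtain ⟨ha, hb⟩ := covBy_of_coveredSet_eq e
  rcases hy with ⟨hy, -⟩ | ⟨hy, -⟩
  · exact ⟨hy.1, hy.2.trans ha.le⟩
  · exact ⟨hy.1, hy.2.trans hb.le⟩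

theorem isLowerSet_setOf_forall_isMin (p : α → Prop) :
    IsLowerSet {x | ∀ y, IsMin y → y ≤ x → p y} :=
  fun _ _ hba ha y hy hyb => ha y hy (hyb.trans hba)

theorem conditionedSet_eq_of_coveredSet_eq {a b x : α} (e : coveredSet x = {a, b}) :
    conditionedSet x = symmDiff (completeUnion a) (completeUnion b) := by
  ext y
  refine ⟨?_, fun hy => ⟨a, b, e, hy⟩⟩
  rintro ⟨c, d, e', hy⟩
  rw [e, Set.pair_eq_pair_iff] at e'
  rcases e' with ⟨rfl, rfl⟩ | ⟨rfl, rfl⟩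
  · exact hy
  · rwa [symmDiff_comm]

theorem marginalization_eq_of_isLowerSet {S : Set α} (hS : IsLowerSet S) (v : α) :
    marginalization S v = {x | x ∈ S ∧ x ≠ v ∧ v ∉ conditionedSet x} := by
  have hS' := isLowerSet_range_subtype hS
  ext x
  constructor
  · rintro ⟨hx, hne, hc⟩
    exact ⟨hx, hne,
      (conditionedSet_apply_of_isLowerSet_range hS' ⟨x, hx⟩).symm ▸ hc⟩
  · rintro ⟨hx, hne, hc⟩
    refine ⟨hx, hne, ?_⟩
    have := conditionedSet_apply_of_isLowerSet_range hS' ⟨x, hx⟩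
    exact fun h => hc (this.symm ▸ h)

/-- The ordering `v` of the minimal elements is an elimination ordering if the last minimal element
below a node always belongs to its conditioned set. -/
def IsEliminationOrder {ℓ : ℕ} (v : Fin ℓ → {x : α // IsMin x}) : Prop :=
  ∀ (k : Fin ℓ) (x : α), (v k).1 < x → (∀ y, IsMin y → y ≤ x → ∃ j ≤ k, (v j).1 = y) →
    (v k).1 ∈ conditionedSet x

/-- By descending induction. Marginalizing by `v i` removes only nodes above it, since conditioned
sets lie in complete unions; it removes all of them, since `v i` is the last minimal element still
present. -/
theorem IsEliminationOrder.successiveMarginalization_eq {ℓ : ℕ} {v : Fin ℓ ≃ {x : α // IsMin x}}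
    (hv : IsEliminationOrder v) (i : Fin (ℓ + 1)) :
    successiveMarginalization v i =
      {x | ∀ y, IsMin y → y ≤ x → ∃ j : Fin ℓ, (j : ℕ) < i ∧ (v j).1 = y} := by
  induction i using Fin.reverseInduction with
  | last =>
    rw [successiveMarginalization, Fin.reverseInduction_last, eq_comm, Set.eq_univ_iff_forall]
    intro x y hy _
    exact ⟨v.symm ⟨y, hy⟩, (v.symm ⟨y, hy⟩).2, by simp⟩
  | cast i ih =>
    rw [successiveMarginalization, Fin.reverseInduction_castSucc]
    rw [successiveMarginalization] at ih
    rw [ih, marginalization_eq_of_isLowerSet (isLowerSet_setOf_forall_isMin _)]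
    ext x
    constructor
    · rintro ⟨hx, hne, hc⟩ y hy hyx
      obtain ⟨j, hj, rfl⟩ := hx y hy hyx
      refine ⟨j, ?_, rfl⟩
      rw [Fin.val_succ] at hj
      rw [Fin.val_castSucc]
      by_contra hji
      obtain rfl : j = i := Fin.ext (by omega)
      refine hc (hv j x (lt_of_le_of_ne hyx hne.symm) fun z hz hzx => ?_)
      obtain ⟨m, hm, e⟩ := hx z hz hzx
      rw [Fin.val_succ] at hm
      exact ⟨m, Fin.le_def.2 (by omega), e⟩
    · intro hx
      have hlt : ¬ (v i).1 ≤ x := by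
        intro hle
        obtain ⟨j, hj, e⟩ := hx _ (v i).2 hle
        rw [v.injective (Subtype.ext e), Fin.val_castSucc] at hj
        exact lt_irrefl _ hj
      refine ⟨fun y hy hyx => ?_, fun e => hlt e.ge,
        fun hc => hlt (conditionedSet_subset_completeUnion x hc).2⟩
      obtain ⟨j, hj, e⟩ := hx y hy hyx
      rw [Fin.val_castSucc] at hj
      exact ⟨j, by rw [Fin.val_succ]; omega, e⟩

theorem IsEliminationOrder.isSamplingOrder [Finite α] {rk : α → ℕ} (h : IsLRVine rk) {ℓ : ℕ}
    {v : Fin ℓ ≃ {x : α // IsMin x}} (hv : IsEliminationOrder v) : IsSamplingOrder rk v := by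
  intro i _ _
  refine h.subtype ?_
  rw [hv.successiveMarginalization_eq]
  exact isLowerSet_setOf_forall_isMin _

end Sampling

/-! ### Complete unions, meets and joins in an LR-vine. -/

section Meet

variable {α : Type*} [PartialOrder α] [Finite α] {rk : α → ℕ}

theorem posetRank_Iic (h : StrictMono rk) (x : α) :
    posetRank (fun y : Set.Iic x => rk y) = rk x := by
  have : Nonempty (Set.Iic x) := ⟨⟨x, le_rfl⟩⟩
  refine le_antisymm (ciSup_le fun y => h.monotone y.2) ?_
  exact rk_le_posetRank (fun y : Set.Iic x => rk y) ⟨x, le_rfl⟩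

theorem IsLRVine.ncard_completeUnion (h : IsLRVine rk) (x : α) :
    (completeUnion x).ncard = rk x := by
  rw [← posetRank_Iic h.isVine.isRankFunction.strictMono x, (h.isRVine_Iic x).rank_eq_dim, dim,
    ← Set.ncard_image_of_injective _ Subtype.val_injective]
  congr 1
  have hS := isLowerSet_range_subtype (isLowerSet_Iic x)
  ext y
  constructor
  · rintro ⟨hy, hyx⟩
    exact ⟨⟨y, hyx⟩, (isMin_apply_iff_of_isLowerSet_range hS (a := ⟨y, hyx⟩)).1 hy, rfl⟩
  · rintro ⟨y, hy, rfl⟩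
    exact ⟨(isMin_apply_iff_of_isLowerSet_range hS).2 hy, y.2⟩

/-- The union of `U_a` and `U_b` is `U_x`, and `|U_x| = rk x = rk b + 1 = |U_b| + 1`. -/
theorem IsLRVine.exists_diff_completeUnion_eq (h : IsLRVine rk) {a b x : α}
    (e : coveredSet x = {a, b}) : ∃ i, completeUnion a \ completeUnion b = {i} := by
  obtain ⟨ha, hb⟩ := covBy_of_coveredSet_eq e
  have hU : completeUnion x = completeUnion a ∪ completeUnion b := by
    ext y
    constructor
    · rintro ⟨hy, hyx⟩
      have hlt : y < x := lt_of_le_of_ne hyx (by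
        rintro rfl
        exact ha.lt.not_isMin hy)
      exact (le_or_le_of_coveredSet_eq e hlt).imp (⟨hy, ·⟩) (⟨hy, ·⟩)
    · rintro (hy | hy)
      exacts [⟨hy.1, hy.2.trans ha.le⟩, ⟨hy.1, hy.2.trans hb.le⟩]
  have hc := Set.ncard_sdiff_add_ncard (completeUnion a) (completeUnion b)
  rw [← hU, h.ncard_completeUnion, h.ncard_completeUnion,
    ← h.isVine.isRankFunction.covBy _ _ hb] at hc
  exact Set.ncard_eq_one.1 (by omega)

/-- The part of the `k`-th associated graph inside the principal ideal of `p`. -/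
def idealLevelGraph (rk : α → ℕ) (p : α) (k : ℕ) : SimpleGraph {x : α // rk x = k} where
  Adj a b := a ≠ b ∧ ∃ w ≤ p, coveredSet w = {a.1, b.1}
  symm := ⟨fun _ _ h => ⟨h.1.symm, by
    obtain ⟨w, hw, h2⟩ := h.2
    exact ⟨w, hw, by rw [h2, Set.pair_comm]⟩⟩⟩
  loopless := ⟨fun _ h => h.1 rfl⟩

theorem IsLRVine.idealLevelGraph_le (h : IsLRVine rk) (p : α) (k : ℕ) :
    idealLevelGraph rk p k ≤ levelGraph rk k := by
  rintro a b ⟨hab, w, hw, e⟩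
  refine ⟨hab, w, ?_, e⟩
  rw [← h.isVine.isRankFunction.covBy _ _ (covBy_of_coveredSet_eq e).1, a.2]

/-- The level graph of the ideal of `p` is a tree. Its copy here has the whole level as node set, so
only nodes below `p` are linked. -/
theorem IsLRVine.idealLevelGraph_reachable (h : IsLRVine rk) {p : α} {k : ℕ} (hk : 1 ≤ k)
    {a b : {x : α // rk x = k}} (ha : a.1 ≤ p) (hb : b.1 ≤ p) :
    (idealLevelGraph rk p k).Reachable a b := by
  have hmono := h.isVine.isRankFunction.strictMono
  have ht := (h.isRVine_Iic p).isTree k hk (by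
    rw [posetRank_Iic hmono, ← a.2]
    exact hmono.monotone ha)
  have hr := ht.connected.preconnected ⟨⟨a.1, ha⟩, a.2⟩ ⟨⟨b.1, hb⟩, b.2⟩
  let f : levelGraph (fun x : Set.Iic p => rk x) k →g idealLevelGraph rk p k :=
    { toFun := fun x => ⟨x.1.1, x.2⟩
      map_rel' := by
        rintro x y ⟨hne, w, -, e⟩
        refine ⟨fun e => hne (Subtype.ext (Subtype.ext (Subtype.mk.inj e))), w.1, w.2, ?_⟩
        have := coveredSet_apply_of_isLowerSet_range (isLowerSet_range_subtype (isLowerSet_Iic p)) w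
        refine this.trans ?_
        rw [e, Set.image_pair]
        rfl }
  exact hr.map f

/-- The path from `a` to `b` in the forest is unique, so it runs inside both ideals; `w` is its
first edge. -/
theorem IsLRVine.exists_covBy_of_le_of_le (h : IsLRVine rk) {p q a b : α} (hab : a ≠ b)
    (hrk : rk a = rk b) (hap : a ≤ p) (hbp : b ≤ p) (haq : a ≤ q) (hbq : b ≤ q) :
    ∃ w, a ⋖ w ∧ w ≤ p ∧ w ≤ q := by
  have hk := h.isVine.isRankFunction.one_le a
  obtain ⟨c, ⟨hac, v, hv, ev⟩, ⟨-, w, hw, ew⟩⟩ :=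
    (h.isVine.levelGraph_isAcyclic hk).exists_adj_of_reachable_of_reachable
      (h.idealLevelGraph_le p _) (h.idealLevelGraph_le q _)
      (a := ⟨a, rfl⟩) (b := ⟨b, hrk.symm⟩) (fun e => hab (congrArg Subtype.val e))
      (h.idealLevelGraph_reachable hk hap hbp) (h.idealLevelGraph_reachable hk haq hbq)
  obtain rfl := h.isVine.eq_of_coveredSet_eq (fun e => hac (Subtype.ext e)) ev ew
  exact ⟨v, (covBy_of_coveredSet_eq ev).1, hv, hw⟩

theorem IsVine.exists_le_rk_eq (h : IsVine rk) {x : α} {k : ℕ} (hk : 1 ≤ k) (hx : k ≤ rk x) :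
    ∃ y ≤ x, rk y = k := by
  induction hn : rk x - k generalizing x with
  | zero => exact ⟨x, le_rfl, by omega⟩
  | succ n ih =>
    obtain ⟨p, q, -, e⟩ := h.exists_coveredSet_eq (v := x) (fun hm => by
      have := h.isRankFunction.isMin x hm
      omega)
    have hp := (covBy_of_coveredSet_eq e).1
    have rp := h.isRankFunction.covBy _ _ hp
    obtain ⟨y, hy, hyk⟩ := ih (x := p) (by omega) (by omega)
    exact ⟨y, hy.trans hp.le, hyk⟩

/-- Two elements with a common lower bound have a meet. -/
theorem IsLRVine.exists_isGreatest (h : IsLRVine rk) {p q z : α} (hzp : z ≤ p) (hzq : z ≤ q) :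
    ∃ m, IsGreatest {x | x ≤ p ∧ x ≤ q} m := by
  have hone := h.isVine.isRankFunction.one_le
  obtain ⟨m, ⟨hmp, hmq⟩, hm⟩ := Set.exists_max_image {x | x ≤ p ∧ x ≤ q} rk (Set.toFinite _)
    ⟨z, hzp, hzq⟩
  refine ⟨m, ⟨hmp, hmq⟩, fun a ha => ?_⟩
  -- Compare `b` with some `c ≤ m` of the same rank: if they differ, `b` has a cover below both `p`
  -- and `q`, against maximality.
  obtain ⟨b, hab, hb⟩ := Finite.exists_le_maximal (p := fun x => x ≤ p ∧ x ≤ q) ha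
  obtain ⟨c, hcm, hc⟩ := h.isVine.exists_le_rk_eq (hone b) (hm b hb.prop)
  by_cases hbc : b = c
  · exact hab.trans (hbc ▸ hcm)
  · obtain ⟨w, hbw, hw⟩ := h.exists_covBy_of_le_of_le hbc hc.symm hb.prop.1 (hcm.trans hmp)
      hb.prop.2 (hcm.trans hmq)
    exact absurd (hb.le_of_ge hw hbw.le) hbw.lt.not_ge

/-- Two distinct minimal elements that are bounded above have a join, and they form its conditioned
set. -/
theorem IsLRVine.exists_isLUB (h : IsLRVine rk) {i j x : α} (hi : IsMin i) (hj : IsMin j)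
    (hij : i ≠ j) (hix : i ≤ x) (hjx : j ≤ x) :
    ∃ w ≤ x, IsLUB {i, j} w ∧ ¬ IsMin w ∧ conditionedSet w = {i, j} := by
  obtain ⟨w, hwx, hw⟩ := Finite.exists_le_minimal (p := fun x => i ≤ x ∧ j ≤ x) (a := x) ⟨hix, hjx⟩
  have hmin : ¬ IsMin w := fun hm => hij ((hm.eq_of_le hw.prop.1).trans (hm.eq_of_le hw.prop.2).symm)
  refine ⟨w, hwx, ⟨?_, fun y hy => ?_⟩, hmin, ?_⟩
  · rintro y (rfl | rfl)
    exacts [hw.prop.1, hw.prop.2]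
  -- The meet of `w` and `y` still bounds `i` and `j`, so it is `w` by minimality.
  · obtain ⟨m, ⟨hmw, hmy⟩, hm⟩ := h.exists_isGreatest hw.prop.1 (hy (Set.mem_insert i _))
    exact (hw.le_of_le ⟨hm ⟨hw.prop.1, hy (Set.mem_insert _ _)⟩,
      hm ⟨hw.prop.2, hy (Set.mem_insert_of_mem _ rfl)⟩⟩ hmw).trans hmy
  · obtain ⟨a, b, hab, e⟩ := h.isVine.exists_coveredSet_eq hmin
    obtain ⟨ha, hb⟩ := covBy_of_coveredSet_eq e
    have hna : ¬ (i ≤ a ∧ j ≤ a) := fun hc => ha.lt.not_ge (hw.le_of_le hc ha.le)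
    have hnb : ¬ (i ≤ b ∧ j ≤ b) := fun hc => hb.lt.not_ge (hw.le_of_le hc hb.le)
    have hlt : ∀ y, IsMin y → y ≤ w → y < w := fun y hy hyw => lt_of_le_of_ne hyw (by
      rintro rfl
      exact hmin hy)
    have key : ∀ a b : α, coveredSet w = {a, b} → i ≤ a → ¬ i ≤ b → j ≤ b → ¬ j ≤ a →
        conditionedSet w = {i, j} := by
      intro a b e hia hib hjb hja
      obtain ⟨i', hi'⟩ := h.exists_diff_completeUnion_eq e
      obtain ⟨j', hj'⟩ := h.exists_diff_completeUnion_eq (e.trans (Set.pair_comm _ _))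
      have h1 : i ∈ completeUnion a \ completeUnion b := ⟨⟨hi, hia⟩, fun hc => hib hc.2⟩
      have h2 : j ∈ completeUnion b \ completeUnion a := ⟨⟨hj, hjb⟩, fun hc => hja hc.2⟩
      rw [hi'] at h1
      rw [hj'] at h2
      rw [conditionedSet_eq_of_coveredSet_eq e, Set.symmDiff_def, hi', hj',
        Set.mem_singleton_iff.1 h1, Set.mem_singleton_iff.1 h2]
      rfl
    rcases le_or_le_of_coveredSet_eq e (hlt i hi hw.prop.1) with hia | hib
    · have hja : ¬ j ≤ a := fun hja => hna ⟨hia, hja⟩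
      have hjb := (le_or_le_of_coveredSet_eq e (hlt j hj hw.prop.2)).resolve_left hja
      exact key a b e hia (fun hib => hnb ⟨hib, hjb⟩) hjb hja
    · have hjb : ¬ j ≤ b := fun hjb => hnb ⟨hib, hjb⟩
      have hja := (le_or_le_of_coveredSet_eq e (hlt j hj hw.prop.2)).resolve_right hjb
      exact key b a (e.trans (Set.pair_comm _ _)) hib (fun hia => hna ⟨hia, hja⟩) hja hjb

end Meet

/-! ### MAT-PEOs are elimination orders, and elimination orders exist. -/

section Main

variable {α : Type*} [PartialOrder α] {rk : α → ℕ}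

theorem Omega_label_eq {i j : {x : α // IsMin x}} {w : α} (hw : IsLUB {i.1, j.1} w) :
    (Omega rk).label s(i, j) = rk w - 1 := by
  have hset : {x : α | ∃ k ∈ s(i, j), x = k.1} = {i.1, j.1} := by
    ext x
    constructor
    · rintro ⟨k, hk, rfl⟩
      rcases Sym2.mem_iff.1 hk with rfl | rfl
      exacts [Set.mem_insert _ _, Set.mem_insert_of_mem _ rfl]
    · rintro (rfl | rfl)
      exacts [⟨i, by simp, rfl⟩, ⟨j, by simp, rfl⟩]
  have hex : ∃ w : α, IsLUB {x : α | ∃ k ∈ s(i, j), x = k.1} w := ⟨w, hset.symm ▸ hw⟩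
  have : (Omega rk).label s(i, j) = rk hex.choose - 1 := dif_pos hex
  rw [this, hex.choose_spec.unique (hset.symm ▸ hw)]

variable [Finite α]

theorem mem_conditionedSet_of_not_le {v a b x : α} (hv : IsMin v)
    (e : coveredSet x = {a, b}) (hvx : v < x) (hn : ¬ (v ≤ a ∧ v ≤ b)) : v ∈ conditionedSet x := by
  rw [conditionedSet_eq_of_coveredSet_eq e]
  rcases le_or_le_of_coveredSet_eq e hvx with hva | hvb
  · exact Or.inl ⟨⟨hv, hva⟩, fun hc => hn ⟨hva, hc.2⟩⟩
  · exact Or.inr ⟨⟨hv, hvb⟩, fun hc => hn ⟨hc.2, hvb⟩⟩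

theorem IsLRVine.isEliminationOrder_of_isMATPEO (h : IsLRVine rk) {ℓ : ℕ}
    {v : Fin ℓ ≃ {x : α // IsMin x}} (hv : (Omega rk).IsMATPEO v) : IsEliminationOrder v := by
  intro k x hkx hx
  obtain ⟨a, b, hab, e⟩ := h.isVine.exists_coveredSet_eq (v := x) hkx.not_isMin
  obtain ⟨ha, hb⟩ := covBy_of_coveredSet_eq e
  refine mem_conditionedSet_of_not_le (v k).2 e hkx ?_
  rintro ⟨hva, hvb⟩
  -- The join of `i` and `v k` lies below `a`, hence has rank less than `rk x`. Used for `(a, b)`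
  -- and for `(b, a)`.
  have hstep : ∀ a b : α, a ≠ b → a ⋖ x → b ⋖ x → (v k).1 ≤ a → (v k).1 ≤ b →
      ∃ i : ((v '' Set.Iic k : Set {x : α // IsMin x})), i.1.1 ≤ a ∧ ¬ i.1.1 ≤ b ∧
        i ∈ ((Omega rk).induce (v '' Set.Iic k)).graph.neighborSet
          ⟨v k, k, Set.self_mem_Iic, rfl⟩ ∧
        ((Omega rk).induce (v '' Set.Iic k)).label s(i, ⟨v k, k, Set.self_mem_Iic, rfl⟩) <
          rk x - 1 := by
    intro a b hab ha hb hva hvb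
    obtain ⟨i, hi⟩ := h.exists_diff_completeUnion_eq (h.isVine.coveredSet_eq_of_covBy hab ha hb)
    have hmem : i ∈ completeUnion a \ completeUnion b := hi ▸ rfl
    obtain ⟨⟨himin, hia⟩, hib⟩ := hmem
    have hib : ¬ i ≤ b := fun hc => hib ⟨himin, hc⟩
    obtain ⟨m, hm, hmi⟩ := hx i himin (hia.trans ha.le)
    have hne : i ≠ (v k).1 := by
      rintro rfl
      exact hib hvb
    obtain ⟨w, hwa, hlub, hwmin, hC⟩ := h.exists_isLUB himin (v k).2 hne hia hva
    have hvm : v m = ⟨i, himin⟩ := Subtype.ext hmi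
    refine ⟨⟨⟨i, himin⟩, m, hm, hvm⟩, hia, hib, ?_, ?_⟩
    · refine (SimpleGraph.mem_neighborSet _ _ _).2 (SimpleGraph.Adj.symm ?_)
      exact ⟨fun e => hne (congrArg Subtype.val e), w, hwmin, hC⟩
    · have hl : ((Omega rk).induce (v '' Set.Iic k)).label
          s(⟨⟨i, himin⟩, m, hm, hvm⟩, ⟨v k, k, Set.self_mem_Iic, rfl⟩) = rk w - 1 :=
        Omega_label_eq (i := ⟨i, himin⟩) (j := v k) hlub
      rw [hl]
      have h1 := h.isVine.isRankFunction.one_le w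
      have h2 := h.isVine.isRankFunction.strictMono (lt_of_le_of_lt hwa ha.lt)
      omega
  obtain ⟨i, hia, hib, hi, hil⟩ := hstep a b hab ha hb hva hvb
  obtain ⟨j, hjb, hja, hj, hjl⟩ := hstep b a hab.symm hb ha hvb hva
  have hne : i.1.1 ≠ j.1.1 := fun e => hib (e ▸ hjb)
  have hlt := (hv k).lt_max i hi j hj (fun e => hne (e ▸ rfl))
  obtain ⟨w, hwx, hlub, -, -⟩ := h.exists_isLUB i.1.2 j.1.2 hne (hia.trans ha.le) (hjb.trans hb.le)
  -- A join strictly below `x` would lie below `a` or `b`, but neither bounds both `i` and `j`.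
  obtain rfl : w = x := by
    by_contra hwx'
    rcases le_or_le_of_coveredSet_eq e (lt_of_le_of_ne hwx hwx') with hwa | hwb
    · exact hja ((hlub.1 (Set.mem_insert_of_mem _ rfl)).trans hwa)
    · exact hib ((hlub.1 (Set.mem_insert _ _)).trans hwb)
  have hl : ((Omega rk).induce (v '' Set.Iic k)).label s(i, j) = rk w - 1 :=
    Omega_label_eq (i := i.1) (j := j.1) hlub
  rw [hl] at hlt
  exact absurd (hlt.trans (max_lt hil hjl)) (lt_irrefl _)

/-- In every nonempty set `T` of minimal elements, some `v` belongs to the conditioned sets of all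
nodes above it whose complete unions lie in `T`. -/
theorem IsLRVine.exists_mem_conditionedSet (h : IsLRVine rk) {T : Set {x : α // IsMin x}}
    (hT : T.Nonempty) : ∃ v ∈ T, ∀ x, v.1 < x →
      (∀ y : {x : α // IsMin x}, y.1 ≤ x → y ∈ T) → v.1 ∈ conditionedSet x := by
  let S : Set α := {x | ∀ y, IsMin y → y ≤ x → ∃ z ∈ T, z.1 = y}
  have hS : IsLowerSet S := isLowerSet_setOf_forall_isMin _
  obtain ⟨t, ht⟩ := hT
  have : Nonempty S := ⟨⟨t.1, fun y _ hyt => ⟨t, ht, (t.2.eq_of_le hyt).symm⟩⟩⟩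
  -- Being unsplit within `S` is enough, as only nodes with complete union in `T` are tested.
  obtain ⟨v, hvmin, hv⟩ := (h.subtype hS).exists_isMin_isUnsplit
  have hvmin' : IsMin v.1 :=
    (isMin_apply_iff_of_isLowerSet_range (isLowerSet_range_subtype hS)).2 hvmin
  obtain ⟨z, hz, hzv⟩ := v.2 v.1 hvmin' le_rfl
  refine ⟨z, hz, fun x hzx hx => ?_⟩
  have hxS : x ∈ S := fun y hy hyx => ⟨⟨y, hy⟩, hx ⟨y, hy⟩ hyx, rfl⟩
  obtain ⟨a, b, hab, e⟩ := h.isVine.exists_coveredSet_eq (v := x) hzx.not_isMin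
  obtain ⟨ha, hb⟩ := covBy_of_coveredSet_eq e
  refine mem_conditionedSet_of_not_le z.2 e hzx ?_
  rintro ⟨hza, hzb⟩
  rw [hzv] at hza hzb
  exact hab (congrArg Subtype.val (hv ⟨x, hxS⟩ ⟨a, hS ha.le hxS⟩ ⟨b, hS hb.le hxS⟩
    ((covBy_subtype_iff hS).2 ha) ((covBy_subtype_iff hS).2 hb) hza hzb))

/-- The element found in `T` is placed last, and the rest of `T` is ordered by induction. -/
theorem IsLRVine.exists_partial_isEliminationOrder (h : IsLRVine rk) (n : ℕ) :
    ∀ T : Set {x : α // IsMin x}, T.ncard = n → ∃ v : Fin n → {x : α // IsMin x},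
      Function.Injective v ∧ Set.range v = T ∧ IsEliminationOrder v := by
  induction n with
  | zero =>
    intro T hT
    rw [Set.ncard_eq_zero] at hT
    exact ⟨Fin.elim0, fun i => i.elim0, by rw [hT, Set.range_eq_empty], fun i => i.elim0⟩
  | succ n ih =>
    intro T hT
    obtain ⟨t, ht, hc⟩ := h.exists_mem_conditionedSet (T := T)
      (Set.nonempty_of_ncard_ne_zero (by omega))
    obtain ⟨v, hinj, hrange, hv⟩ := ih (T \ {t}) (by
      have := Set.ncard_sdiff_singleton_add_one ht
      omega)
    have htv : t ∉ Set.range v := by simp [hrange]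
    have hrange' : Set.range (Fin.snoc v t : Fin (n + 1) → {x : α // IsMin x}) = T := by
      rw [Fin.range_snoc, hrange, Set.insert_sdiff_singleton, Set.insert_eq_of_mem ht]
    refine ⟨Fin.snoc v t, Fin.snoc_injective_iff.2 ⟨hinj, htv⟩, hrange', fun k => ?_⟩
    induction k using Fin.lastCases with
    | last =>
      intro x hx hxT
      rw [Fin.snoc_last] at hx ⊢
      refine hc x hx fun y hyx => ?_
      obtain ⟨j, -, hj⟩ := hxT y.1 y.2 hyx
      rw [← hrange']
      exact ⟨j, Subtype.ext hj⟩
    | cast k =>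
      intro x hx hxT
      rw [Fin.snoc_castSucc] at hx ⊢
      refine hv k x hx fun y hy hyx => ?_
      obtain ⟨j, hjk, hj⟩ := hxT y hy hyx
      induction j using Fin.lastCases with
      | last => exact absurd hjk (Fin.castSucc_lt_last k).not_ge
      | cast j =>
        rw [Fin.snoc_castSucc] at hj
        exact ⟨j, Fin.castSucc_le_castSucc_iff.1 hjk, hj⟩

theorem IsLRVine.exists_isEliminationOrder (h : IsLRVine rk) {ℓ : ℕ} (hℓ : dim α = ℓ) :
    ∃ v : Fin ℓ ≃ {x : α // IsMin x}, IsEliminationOrder v := by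
  obtain ⟨v, hinj, hrange, hv⟩ := h.exists_partial_isEliminationOrder ℓ Set.univ (by
    rw [Set.ncard_univ, ← hℓ]
    rfl)
  exact ⟨Equiv.ofBijective v ⟨hinj, Set.range_eq_univ.1 hrange⟩, hv⟩

end Main

end LRVine

theorem mainTheorem7 {P : Type*} [PartialOrder P] [Finite P] (rk : P → ℕ)
    (hP : LRVine.IsLRVine rk) (ℓ : ℕ) (hℓ : LRVine.dim P = ℓ) :
    (∀ v : Fin ℓ ≃ {x : P // IsMin x},
      (LRVine.Omega rk).IsMATPEO v → LRVine.IsSamplingOrder rk v) ∧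
    ∃ v : Fin ℓ ≃ {x : P // IsMin x}, LRVine.IsSamplingOrder rk v := by
  refine ⟨fun v hv => (hP.isEliminationOrder_of_isMATPEO hv).isSamplingOrder hP, ?_⟩
  obtain ⟨v, hv⟩ := hP.exists_isEliminationOrder hℓ
  exact ⟨v, hv.isSamplingOrder hP⟩
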